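/- Let $R$ be a commutative noetherian local ring with maximal ideal $\mathfrak m$ and residue field $k=R/\mathfrak m$, let $t=\operatorname{depth} R$, and let $M$ be a finitely generated $R$-module of depth at least $t$ (the zero module has depth $\infty$). For a finitely generated $R$-module $N$ and a presentation $P_1\xrightarrow{\partial}P_0\to N\to 0$ by finitely generated projective modules, the syzygy and the Auslander transpose of $N$ are $\Omega N=\operatorname{Im}\partial$ and $\operatorname{Tr}N=\operatorname{Coker}(\partial^\ast\colon P_0^\ast\to P_1^\ast)$, where $(-)^\ast=\operatorname{Hom}_R(-,R)$; put $\Omega^0N=N$ and $\Omega^nN=\Omega(\Omega^{n-1}N)$ for $n>0$. Put $\beta_i(M)=\dim_k\operatorname{Tor}^R_i(k,M)$, $\mu_i(M)=\dim_k\operatorname{Ext}_R^i(k,M)$, and let $r(R)=\dim_k\operatorname{Ext}^t_R(k,R)$ be the type of $R$. Then, for every choice of presentations in the formation of $\operatorname{Tr}\Omega^t k$, the module $\operatorname{Ext}^i_R(\operatorname{Tr}\Omega^tk,M)$ is annihilated by $\mathfrak m$, i.e. is a $k$-vector space, and is finite-dimensional, for every integer $i>0$, and the following hold. 1. $\dim_k\operatorname{Ext}^i_R(\operatorname{Tr}\Omega^tk,M)=\beta_{t-i+1}(M)$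 for all $1\le i\le t$. 2. $\dim_k\operatorname{Ext}^{t+1}_R(\operatorname{Tr}\Omega^tk,M)-\dim_k\operatorname{Ext}^{t+2}_R(\operatorname{Tr}\Omega^tk,M)=\beta_0(M)-r(R)\mu_t(M)$. 3. $\dim_k\operatorname{Ext}^i_R(\operatorname{Tr}\Omega^tk,M)=r(R)\mu_{i-2}(M)$ for all $i\ge t+3$. -/

import Mathlib

open CategoryTheory Abelian IsLocalRing

universe u

namespace LocalExt

/-! ### Vector spaces over the residue field -/

section ResidueSpace

variable (R : Type u) [CommRing R] [IsLocalRing R]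

/-- The `R`-module `E` is a vector space over the residue field `k`:
the maximal ideal annihilates `E`, so that the `R`-action factors through `k`. -/
abbrev IsResidueSpace (E : Type u) [AddCommGroup E] [Module R E] : Prop :=
  Module.IsTorsionBySet R E (maximalIdeal R : Set R)

variable {R}

/-- The `k`-vector space structure on an `R`-module annihilated by the maximal ideal;
the class of `r : R` acts as `r`. -/
noncomputable abbrev IsResidueSpace.residueModule {E : Type u} [AddCommGroup E] [Module R E]
    (h : IsResidueSpace R E) : Module (ResidueField R) E :=
  Module.IsTorsionBySet.module (I := maximalIdeal R) h

/-- The dimension over `k` of an `R`-module annihilated by the maximal ideal. It is only used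
for finitely generated `R`-modules, for which it is finite. -/
noncomputable def IsResidueSpace.dim {E : Type u} [AddCommGroup E] [Module R E]
    (h : IsResidueSpace R E) : ℕ :=
  letI := h.residueModule
  Module.finrank (ResidueField R) E

theorem residueField_isResidueSpace : IsResidueSpace R (ResidueField R) := by
  rintro x ⟨r, hr⟩
  change r • x = 0
  rw [Algebra.smul_def]
  have h : algebraMap R (ResidueField R) r = 0 := (residue_eq_zero_iff r).2 hr
  rw [h, zero_mul]

theorem tensor_residueField_isResidueSpace (N : Type u) [AddCommGroup N] [Module R N] :
    IsResidueSpace R (TensorProduct R (ResidueField R) N) := by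
  rintro x ⟨r, hr⟩
  change r • x = 0
  induction x using TensorProduct.induction_on with
  | zero => exact smul_zero r
  | tmul a b =>
    rw [TensorProduct.smul_tmul',
      show r • a = 0 from residueField_isResidueSpace (R := R) (x := a) (a := ⟨r, hr⟩),
      TensorProduct.zero_tmul]
  | add x y hx hy => rw [smul_add, hx, hy, add_zero]

variable (R) in
/-- The residue field `k` as an `R`-module. -/
noncomputable abbrev resField : ModuleCat.{u} R := ModuleCat.of R (ResidueField R)

theorem ext_resField_isResidueSpace (M : ModuleCat.{u} R) (i : ℕ) :
    IsResidueSpace R (Ext (resField R) M i) := by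
  rintro e ⟨r, hr⟩
  change r • e = 0
  have h0 : r • 𝟙 (resField R) = 0 := by
    ext x
    exact residueField_isResidueSpace (R := R) (x := x) (a := ⟨r, hr⟩)
  have h1 : r • e = (Ext.mk₀ (r • 𝟙 (resField R))).comp e (zero_add i) := by
    simp [Ext.mk₀_smul]
  rw [h1, h0]
  simp

theorem tor_resField_isResidueSpace (M : ModuleCat.{u} R) (i : ℕ) :
    IsResidueSpace R (((Tor (ModuleCat.{u} R) i).obj (resField R)).obj M) := by
  rintro e ⟨r, hr⟩
  change r • e = 0
  let F := (MonoidalCategory.tensoringLeft (ModuleCat.{u} R)).obj (resField R)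
  let P := projectiveResolution M
  let K := (F.mapHomologicalComplex (ComplexShape.down ℕ)).obj P.complex
  have hX (j : ℕ) : r • 𝟙 (K.X j) = 0 := by
    ext x
    exact tensor_residueField_isResidueSpace (R := R) (P.complex.X j) (x := x) (a := ⟨r, hr⟩)
  have hS : r • 𝟙 (K.sc i) = 0 := by
    ext1
    · exact hX _
    · exact hX _
    · exact hX _
  have hH : r • 𝟙 (K.homology i) = 0 := by
    have := ShortComplex.homologyMap_smul (𝟙 (K.sc i)) r
    rw [hS, ShortComplex.homologyMap_zero, ShortComplex.homologyMap_id] at this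
    exact this.symm
  let φ : ((Tor (ModuleCat.{u} R) i).obj (resField R)).obj M ≅ K.homology i :=
    P.isoLeftDerivedObj F i
  apply φ.toLinearEquiv.injective
  rw [map_smul, map_zero]
  exact congrArg (fun f => f.hom (φ.toLinearEquiv e)) hH

/-- The Betti number `β_i(M) = dim_k Tor_i(k, M)`. -/
noncomputable def betti (i : ℕ) (M : ModuleCat.{u} R) : ℕ :=
  (tor_resField_isResidueSpace M i).dim

/-- The Bass number `μ_i(M) = dim_k Ext^i(k, M)`. -/
noncomputable def bass (i : ℕ) (M : ModuleCat.{u} R) : ℕ :=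
  (ext_resField_isResidueSpace M i).dim

end ResidueSpace

/-! ### Depth and type -/

section Depth

variable (R : Type u) [CommRing R] [IsLocalRing R]

/-- The depth of a module over a local ring: the supremum of the lengths of `M`-sequences in the
maximal ideal. For finitely generated `M ≠ 0` the condition `M ≠ (x₁, …, xₙ)M` is automatic by
Nakayama's lemma; the zero module gets depth `∞`, as usual. -/
noncomputable def depth (M : Type u) [AddCommGroup M] [Module R M] : ℕ∞ :=
  ⨆ (rs : List R) (_ : (∀ r ∈ rs, r ∈ maximalIdeal R) ∧
    RingTheory.Sequence.IsWeaklyRegular M rs), (rs.length : ℕ∞)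

/-- The type `r(R) = dim_k Ext^{depth R}(k, R)` of a noetherian local ring
(whose depth is finite). -/
noncomputable def ringType : ℕ :=
  bass (depth R R).toNat (ModuleCat.of R R)

end Depth

/-! ### Syzygies and transposes -/

section Syzygy

variable (R : Type u) [CommRing R]

/-- A presentation `P₁ --d--> P₀ --ε--> M → 0` of the `R`-module `M` by finitely generated
projective modules. -/
structure ProjPres (M : Type u) [AddCommGroup M] [Module R M] where
  P₁ : ModuleCat.{u} R
  P₀ : ModuleCat.{u} R
  finite₁ : Module.Finite R P₁
  finite₀ : Module.Finite R P₀
  projective₁ : Module.Projective R P₁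
  projective₀ : Module.Projective R P₀
  d : P₁ →ₗ[R] P₀
  ε : P₀ →ₗ[R] M
  exact : Function.Exact d ε
  surjective : Function.Surjective ε

variable {R}

/-- The first syzygy `Ω M = Im d` given by a presentation. -/
abbrev ProjPres.syzygy {M : Type u} [AddCommGroup M] [Module R M] (P : ProjPres R M) : Type u :=
  LinearMap.range P.d

/-- The Auslander transpose `Tr M = Coker (d^* : P₀^* → P₁^*)` given by a presentation. -/
abbrev ProjPres.transpose {M : Type u} [AddCommGroup M] [Module R M] (P : ProjPres R M) :
    Type u :=
  Module.Dual R P.P₁ ⧸ LinearMap.range P.d.dualMap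

/-- `N` is an `n`-th syzygy `Ω^n M` of `M`, for some choice of presentations. -/
def IsSyzygy : ℕ → ModuleCat.{u} R → ModuleCat.{u} R → Prop
  | 0, M, N => Nonempty (N ≃ₗ[R] M)
  | n + 1, M, N => ∃ L : ModuleCat.{u} R, IsSyzygy n M L ∧
      ∃ P : ProjPres R L, Nonempty (N ≃ₗ[R] P.syzygy)

/-- `T` is an Auslander transpose `Tr N` of `N`, for some choice of a presentation. -/
def IsTranspose (N T : ModuleCat.{u} R) : Prop :=
  ∃ P : ProjPres R N, Nonempty (T ≃ₗ[R] P.transpose)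

end Syzygy

end LocalExt

/-! Write `S` for the given `Ω^t k`, `T` for its transpose and `X` for `Ext^t(k, R)`. Everything is
read off from one long exact sequence `⋯ → Ext^{n+1}(T, M) → Tor_{t-n}(k, M) → Ext^n(X, M) →
Ext^{n+2}(T, M) → ⋯`, which starts with an injection at `n = 0` and in which `Tor` of negative index
is zero. As an `R`-module `X` is `k^r` with `r = r(R)`, so `Ext^n(X, M)` has dimension `r μ_n(M)`
and vanishes for `n < t` because `depth M ≥ t`. Thus the first map is bijective for `n < t`, at `n =
t` a four-term exact sequence remains, and for `n > t` the last map is bijective.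

The sequence compares evaluation maps `S ⊗ M → Hom(J, M)` for submodules `J` of `S^*`. For `J =
S^*`, dualizing a presentation of `S` gives `0 → S^* → P₀^* → P₁^* → T → 0`, so kernel, cokernel,
`Ext^1(S^*, M)`, … are the modules `Ext^{n+1}(T, M)` (`IsTranspose.nonempty_ext_equiv`). For the
image `J = I` of the dual of the projective module containing `S` (`I = 0` if `t = 0`), the same
list is `Tor_t(k, M), …, Tor_0(k, M), 0, …`. This is the invariant `IsDualImage`, proved by
induction along the syzygies; `Ext^n(k, R) = 0` for `n < t` keeps the induction going. Finally
`S^*/I ≅ X`, and the `Ext` sequence of `0 → I → S^* → X → 0`, spliced with the evaluation maps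
(`exists_splice_exact`), is the sequence above. -/

namespace LocalExt

/-! ### Dimension shifting for `Tor` in the first variable. -/

section TorSequence

variable {R : Type u} [CommRing R]

/-- The complex `A ⊗ C`. -/
noncomputable abbrev tensorComplex (A : ModuleCat.{u} R) (C : ChainComplex (ModuleCat.{u} R) ℕ) :
    ChainComplex (ModuleCat.{u} R) ℕ :=
  (((MonoidalCategory.tensoringLeft (ModuleCat.{u} R)).obj A).mapHomologicalComplex
    (ComplexShape.down ℕ)).obj C

/-- The chain map `A ⊗ C ⟶ B ⊗ C`. -/
noncomputable abbrev tensorComplexMap {A B : ModuleCat.{u} R} (f : A ⟶ B)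
    (C : ChainComplex (ModuleCat.{u} R) ℕ) : tensorComplex A C ⟶ tensorComplex B C :=
  (NatTrans.mapHomologicalComplex ((MonoidalCategory.tensoringLeft (ModuleCat.{u} R)).map f)
    (ComplexShape.down ℕ)).app C

/-- The short complex of complexes `X₁ ⊗ C ⟶ X₂ ⊗ C ⟶ X₃ ⊗ C`. -/
noncomputable abbrev tensorShortComplex (S : ShortComplex (ModuleCat.{u} R))
    (C : ChainComplex (ModuleCat.{u} R) ℕ) :
    ShortComplex (ChainComplex (ModuleCat.{u} R) ℕ) :=
  ShortComplex.mk (tensorComplexMap S.f C) (tensorComplexMap S.g C) (by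
    ext i : 1
    change MonoidalCategory.whiskerRight S.f (C.X i) ≫
      MonoidalCategory.whiskerRight S.g (C.X i) = 0
    rw [← MonoidalCategory.comp_whiskerRight, S.zero, MonoidalPreadditive.zero_whiskerRight])

theorem tensorShortComplex_shortExact {S : ShortComplex (ModuleCat.{u} R)} (hS : S.ShortExact)
    (C : ChainComplex (ModuleCat.{u} R) ℕ) [∀ i, Projective (C.X i)] :
    (tensorShortComplex S C).ShortExact := by
  apply HomologicalComplex.shortExact_of_degreewise_shortExact
  intro i
  have : Module.Projective R (C.X i) := (IsProjective.iff_projective (C.X i)).2 inferInstance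
  exact hS.map_of_exact (MonoidalCategory.tensorRight (C.X i))

theorem isZero_homology_tensorComplex_of_flat (P : ModuleCat.{u} R) [Module.Flat R P]
    {M : ModuleCat.{u} R} (Q : ProjectiveResolution M) (j : ℕ) :
    Limits.IsZero ((tensorComplex P Q.complex).homology (j + 1)) := by
  rw [← HomologicalComplex.exactAt_iff_isZero_homology]
  rw [HomologicalComplex.exactAt_iff' _ (j + 2) (j + 1) j (by simp) (by simp)]
  rw [ShortComplex.ShortExact.moduleCat_exact_iff_function_exact]
  exact Module.Flat.lTensor_exact P
    (ShortComplex.ShortExact.moduleCat_exact_iff_function_exact _ |>.1 (Q.exact_succ j))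

/-- The isomorphism `Tor j A M ≅ Hⱼ(A ⊗ Q)` for a projective resolution `Q` of `M`. -/
noncomputable def torIso (A : ModuleCat.{u} R) {M : ModuleCat.{u} R} (Q : ProjectiveResolution M)
    (j : ℕ) :
    ((Tor (ModuleCat.{u} R) j).obj A).obj M ≅ (tensorComplex A Q.complex).homology j :=
  Q.isoLeftDerivedObj ((MonoidalCategory.tensoringLeft (ModuleCat.{u} R)).obj A) j

/-- The isomorphism `H₀(A ⊗ Q) ≅ A ⊗ M` for a projective resolution `Q` of `M`. -/
noncomputable def homologyZeroIso (A : ModuleCat.{u} R) {M : ModuleCat.{u} R}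
    (Q : ProjectiveResolution M) :
    (tensorComplex A Q.complex).homology 0 ≅ MonoidalCategory.tensorObj A M :=
  ChainComplex.isoHomologyι₀ _ ≪≫
    @asIso _ _ _ _ (Q.fromLeftDerivedZero' ((MonoidalCategory.tensoringLeft (ModuleCat.{u} R)).obj A))
      (by
        have : Limits.PreservesFiniteColimits
          ((MonoidalCategory.tensoringLeft (ModuleCat.{u} R)).obj A) :=
            inferInstanceAs (Limits.PreservesFiniteColimits (MonoidalCategory.tensorLeft A))
        infer_instance)

/-- Identifies the map on `H₀` in the long exact sequence with `f ⊗ M`, which makes `Tor₁`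
computable as a kernel. -/
theorem homologyZeroIso_naturality {A B : ModuleCat.{u} R} (f : A ⟶ B) {M : ModuleCat.{u} R}
    (Q : ProjectiveResolution M) :
    HomologicalComplex.homologyMap (tensorComplexMap f Q.complex) 0 ≫ (homologyZeroIso B Q).hom =
      (homologyZeroIso A Q).hom ≫ MonoidalCategory.whiskerRight f M := by
  dsimp [homologyZeroIso]
  simp only [Category.assoc]
  change HomologicalComplex.homologyMap (tensorComplexMap f Q.complex) 0 ≫
    HomologicalComplex.homologyι _ 0 ≫ _ = HomologicalComplex.homologyι _ 0 ≫ _ ≫ _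
  rw [HomologicalComplex.homologyι_naturality_assoc]
  congr 1
  rw [← cancel_epi (HomologicalComplex.pOpcycles _ _)]
  rw [HomologicalComplex.p_opcyclesMap_assoc]
  erw [ProjectiveResolution.pOpcycles_comp_fromLeftDerivedZero',
    ProjectiveResolution.pOpcycles_comp_fromLeftDerivedZero'_assoc]
  exact (MonoidalCategory.whisker_exchange f (Q.π.f 0)).symm

variable {S : ShortComplex (ModuleCat.{u} R)} (hS : S.ShortExact) [Module.Flat R S.X₂]
  (M : ModuleCat.{u} R)

include hS in
/-- Dimension shifting for `Tor` in the first variable. -/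
theorem nonempty_tor_succ_iso (j : ℕ) :
    Nonempty (((Tor (ModuleCat.{u} R) (j + 2)).obj S.X₃).obj M ≅
      ((Tor (ModuleCat.{u} R) (j + 1)).obj S.X₁).obj M) := by
  let Q := projectiveResolution M
  have h := tensorShortComplex_shortExact hS Q.complex
  have hj : (ComplexShape.down ℕ).Rel (j + 2) (j + 1) := by simp
  have : IsIso (h.δ (j + 2) (j + 1) hj) :=
    h.isIso_δ _ _ _ (isZero_homology_tensorComplex_of_flat _ Q _)
      (isZero_homology_tensorComplex_of_flat _ Q _)
  exact ⟨torIso _ Q _ ≪≫ asIso (h.δ (j + 2) (j + 1) hj) ≪≫ (torIso _ Q _).symm⟩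

include hS in
/-- `Tor₁(X₃, M)` is the kernel of `X₁ ⊗ M → X₂ ⊗ M`. -/
theorem nonempty_tor_one_iso :
    Nonempty (((Tor (ModuleCat.{u} R) 1).obj S.X₃).obj M ≃ₗ[R]
      LinearMap.ker (LinearMap.rTensor M S.f.hom)) := by
  let Q := projectiveResolution M
  have h := tensorShortComplex_shortExact hS Q.complex
  let d := h.δ 1 0 (by simp) ≫ (homologyZeroIso S.X₁ Q).hom
  -- Only injectivity survives in this degree: `H₁` of the middle complex vanishes by flatness, but
  -- its `H₀` is `X₂ ⊗ M`.
  have hmono : Mono (h.δ 1 0 (by simp)) :=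
    h.mono_δ _ _ _ (isZero_homology_tensorComplex_of_flat _ Q _)
  have hd : Function.Injective d := (ModuleCat.mono_iff_injective d).1 inferInstance
  have hex : Function.Exact d.hom (LinearMap.rTensor M S.f.hom) := by
    have h1 := h.homology_exact₁ 1 0 (by simp)
    rw [ShortComplex.ShortExact.moduleCat_exact_iff_function_exact] at h1
    have hn := homologyZeroIso_naturality S.f Q
    let e₁ := (homologyZeroIso S.X₁ Q).toLinearEquiv
    let e₂ := (homologyZeroIso S.X₂ Q).toLinearEquiv
    have hn' (x) : e₂ (HomologicalComplex.homologyMap (tensorComplexMap S.f Q.complex) 0 x) =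
        LinearMap.rTensor M S.f.hom (e₁ x) := congrArg (fun f => f.hom x) hn
    intro y
    obtain ⟨x, rfl⟩ := e₁.surjective y
    rw [← hn', LinearEquiv.map_eq_zero_iff]
    refine (h1 x).trans ⟨fun ⟨z, hz⟩ => ⟨z, congrArg e₁ hz⟩, fun ⟨z, hz⟩ => ⟨z, e₁.injective hz⟩⟩
  exact ⟨(torIso _ Q _).toLinearEquiv ≪≫ₗ LinearEquiv.ofInjective d.hom hd ≪≫ₗ
    LinearEquiv.ofEq _ _ hex.linearMap_ker_eq.symm⟩

/-- `Tor₀(A, M) = A ⊗ M`. -/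
noncomputable def torZeroEquiv (A M : ModuleCat.{u} R) :
    ((Tor (ModuleCat.{u} R) 0).obj A).obj M ≃ₗ[R] TensorProduct R A M :=
  (torIso A (projectiveResolution M) 0 ≪≫ homologyZeroIso A _).toLinearEquiv

end TorSequence

/-! ### Modules annihilated by the maximal ideal. -/

section ResidueSpaceLemmas

variable {R : Type u} [CommRing R] [IsLocalRing R]
variable {E E' : Type u} [AddCommGroup E] [Module R E] [AddCommGroup E'] [Module R E']

theorem IsResidueSpace.of_injective (h : IsResidueSpace R E') (f : E →ₗ[R] E')
    (hf : Function.Injective f) : IsResidueSpace R E := by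
  intro x r
  apply hf
  rw [map_zero]
  exact (f.map_smul (r : R) x).trans (h (x := f x) (a := r))

theorem IsResidueSpace.of_surjective (h : IsResidueSpace R E) (f : E →ₗ[R] E')
    (hf : Function.Surjective f) : IsResidueSpace R E' := by
  intro x r
  obtain ⟨y, rfl⟩ := hf x
  exact (f.map_smul (r : R) y).symm.trans ((congrArg f (h (x := y) (a := r))).trans (map_zero f))

/-- Linear maps between residue spaces are `k`-linear. -/
theorem IsResidueSpace.map_smul_residue (h : IsResidueSpace R E) (h' : IsResidueSpace R E')
    (f : E →ₗ[R] E') (c : ResidueField R) (x : E) :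
    letI := h.residueModule
    letI := h'.residueModule
    f (c • x) = c • f x := by
  obtain ⟨r, rfl⟩ := Ideal.Quotient.mk_surjective c
  exact f.map_smul r x

theorem IsResidueSpace.dim_congr (h : IsResidueSpace R E) (h' : IsResidueSpace R E')
    (e : E ≃ₗ[R] E') : h.dim = h'.dim := by
  let := h.residueModule
  let := h'.residueModule
  let e' : E ≃ₗ[ResidueField R] E' :=
    { e with map_smul' := fun c x => h.map_smul_residue h' e.toLinearMap c x }
  exact e'.finrank_eq

theorem IsResidueSpace.finite_residueField (h : IsResidueSpace R E) [Module.Finite R E] :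
    letI := h.residueModule
    Module.Finite (ResidueField R) E := by
  let := h.residueModule
  have : IsScalarTower R (ResidueField R) E := Module.IsTorsionBySet.isScalarTower h
  exact Module.Finite.of_restrictScalars_finite R (ResidueField R) E

theorem IsResidueSpace.length_eq_dim (h : IsResidueSpace R E) [Module.Finite R E] :
    Module.length R E = h.dim := by
  let := h.residueModule
  have : IsScalarTower R (ResidueField R) E := Module.IsTorsionBySet.isScalarTower h
  have := h.finite_residueField
  rw [Module.length_eq_of_surjective (S := R) (R := ResidueField R) (M := E)
    Ideal.Quotient.mk_surjective, Module.length_eq_finrank]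
  rfl

/-- A finitely generated residue space is a finite power of the residue field. -/
theorem IsResidueSpace.nonempty_equiv_pi (h : IsResidueSpace R E) [Module.Finite R E] :
    Nonempty (E ≃ₗ[R] (Fin h.dim → ResidueField R)) := by
  let := h.residueModule
  have : IsScalarTower R (ResidueField R) E := Module.IsTorsionBySet.isScalarTower h
  have := h.finite_residueField
  exact ⟨((Module.finBasis (ResidueField R) E).equivFun).restrictScalars R⟩

/-- Cut the sequence at the image of `g` and use that length over `R` is additive and equals
dimension over `k`. -/
theorem dim_sub_dim_of_exact [IsNoetherianRing R] {A B C D : Type u} [AddCommGroup A] [Module R A]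
    [AddCommGroup B] [Module R B] [AddCommGroup C] [Module R C] [AddCommGroup D] [Module R D]
    [Module.Finite R B] [Module.Finite R C]
    (hA : IsResidueSpace R A) (hB : IsResidueSpace R B) (hC : IsResidueSpace R C)
    (hD : IsResidueSpace R D) (f : A →ₗ[R] B) (g : B →ₗ[R] C) (p : C →ₗ[R] D)
    (hf : Function.Injective f) (hfg : Function.Exact f g) (hgp : Function.Exact g p)
    (hp : Function.Surjective p) : (hA.dim : ℤ) - hD.dim = (hB.dim : ℤ) - hC.dim := by
  have : Module.Finite R A := Module.Finite.of_injective f hf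
  have : Module.Finite R D := Module.Finite.of_surjective p hp
  have hG : IsResidueSpace R (LinearMap.range g) := hC.of_injective _ (Submodule.subtype_injective _)
  have h₁ := Module.length_eq_add_of_exact f g.rangeRestrict hf g.surjective_rangeRestrict
    (fun x => by
      rw [← hfg x]
      exact Subtype.ext_iff)
  have h₂ := Module.length_eq_add_of_exact (LinearMap.range g).subtype p
    (Submodule.subtype_injective _) hp (fun x => by rw [hgp x]; simp)
  rw [hA.length_eq_dim, hB.length_eq_dim, hG.length_eq_dim] at h₁
  rw [hC.length_eq_dim, hD.length_eq_dim, hG.length_eq_dim] at h₂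
  norm_cast at h₁ h₂
  omega

end ResidueSpaceLemmas

/-! ### Vanishing of `Ext(k, M)` below the depth. -/

section Depth

variable {R : Type u} [CommRing R] [IsLocalRing R]

/-- Multiplication by the first element `a` is injective on `M` but zero on `Ext(k, M)`. Hence every
class in `Ext^{i+1}(k, M)` comes from `Ext^i(k, M/aM)`, which vanishes by induction on the sequence.
-/
theorem subsingleton_ext_of_isWeaklyRegular (rs : List R) (hrs : ∀ r ∈ rs, r ∈ maximalIdeal R)
    (M : ModuleCat.{u} R) (h : RingTheory.Sequence.IsWeaklyRegular M rs) (i : ℕ)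
    (hi : i < rs.length) : Subsingleton (Ext (resField R) M i) := by
  induction rs generalizing M i with
  | nil => simp at hi
  | cons a rs ih =>
    rw [RingTheory.Sequence.isWeaklyRegular_cons_iff] at h
    have hS := h.1.smulShortComplex_shortExact
    have hz (e : Ext (resField R) M i) : a • e = 0 :=
      ext_resField_isResidueSpace M i (x := e) (a := ⟨a, hrs a (by simp)⟩)
    refine ⟨fun x y => ?_⟩
    rw [← sub_eq_zero]
    have hx : (x - y).comp (Ext.mk₀ (M.smulShortComplex a).f) (add_zero i) = 0 := by
      change (x - y).comp (Ext.mk₀ (a • 𝟙 M)) (add_zero i) = 0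
      rw [← Ext.smul_eq_comp_mk₀]
      exact hz (x - y)
    cases i with
    | zero =>
      have : Mono (M.smulShortComplex a).f := hS.mono_f
      exact Ext.postcomp_mk₀_injective_of_mono _ (M.smulShortComplex a).f
        (hx.trans (map_zero ((Ext.mk₀ (M.smulShortComplex a).f).postcomp _ (add_zero 0))).symm)
    | succ i =>
      obtain ⟨z, hz⟩ := Ext.covariant_sequence_exact₁ _ hS (x - y) hx rfl
      have := ih (fun r hr => hrs r (List.mem_cons_of_mem _ hr))
        (ModuleCat.of R (QuotSMulTop a M)) h.2 i (by simpa using hi)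
      have hz0 : z = 0 := Subsingleton.elim (α := Ext (resField R)
        (ModuleCat.of R (QuotSMulTop a M)) i) _ _
      rw [← hz, hz0]
      exact Ext.zero_comp (resField R) i hS.extClass (i + 1) rfl

theorem subsingleton_ext_of_lt_depth {M : ModuleCat.{u} R} {i : ℕ}
    (h : (i : ℕ∞) < depth R M) : Subsingleton (Ext (resField R) M i) := by
  simp only [depth, lt_iSup_iff] at h
  obtain ⟨rs, hrs, hi⟩ := h
  exact subsingleton_ext_of_isWeaklyRegular rs hrs.1 M hrs.2 i (by exact_mod_cast hi)

end Depth

/-! ### Contravariant long exact sequence of `Ext`. -/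

section ExtSequence

variable {R : Type u} [CommRing R] {S : ShortComplex (ModuleCat.{u} R)} (hS : S.ShortExact)
  (M : ModuleCat.{u} R)

include hS in
theorem exact_precomp₂ (n : ℕ) :
    Function.Exact ((Ext.mk₀ S.g).precompOfLinear R M (zero_add n))
      ((Ext.mk₀ S.f).precompOfLinear R M (zero_add n)) := by
  have := Ext.contravariant_sequence_exact₂' hS M n
  rw [ShortComplex.ab_exact_iff_function_exact] at this
  exact this

theorem exact_precomp₁ {n n' : ℕ} (h : 1 + n = n') :
    Function.Exact ((Ext.mk₀ S.f).precompOfLinear R M (zero_add n))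
      (hS.extClass.precompOfLinear R M h) := by
  have := Ext.contravariant_sequence_exact₁' hS M n n' h
  rw [ShortComplex.ab_exact_iff_function_exact] at this
  exact this

theorem exact_precomp₃ {n n' : ℕ} (h : 1 + n = n') :
    Function.Exact (hS.extClass.precompOfLinear R M h)
      ((Ext.mk₀ S.g).precompOfLinear R M (zero_add n')) := by
  have := Ext.contravariant_sequence_exact₃' hS M n n' h
  rw [ShortComplex.ab_exact_iff_function_exact] at this
  exact this

include hS in
theorem injective_precomp_zero :
    Function.Injective ((Ext.mk₀ S.g).precompOfLinear R M (zero_add 0)) := by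
  have : Epi S.g := hS.epi_g
  exact Ext.precomp_mk₀_injective_of_epi M S.g

/-- `Ext⁰(A, M) = Hom(A, M)`. -/
noncomputable def extZeroEquiv (A M : ModuleCat.{u} R) : Ext A M 0 ≃ₗ[R] (A →ₗ[R] M) :=
  Ext.linearEquiv₀.trans ModuleCat.homLinearEquiv

@[simp]
theorem extZeroEquiv_mk₀ {A M : ModuleCat.{u} R} (f : A ⟶ M) :
    extZeroEquiv A M (Ext.mk₀ f) = f.hom := by
  have : Ext.linearEquiv₀ (R := R) (Ext.mk₀ f) = f :=
    (Ext.linearEquiv₀ (R := R)).apply_symm_apply f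
  simp [extZeroEquiv, this]

theorem extZeroEquiv_precomp {A B M : ModuleCat.{u} R} (f : A ⟶ B) (x : Ext B M 0) :
    extZeroEquiv A M ((Ext.mk₀ f).precompOfLinear R M (zero_add 0) x) =
      (extZeroEquiv B M x).comp f.hom := by
  obtain ⟨g, rfl⟩ := (Ext.mk₀_bijective _ _).2 x
  simp

include hS in
theorem nonempty_ext_one_equiv [Projective S.X₂] :
    Nonempty (Ext S.X₃ M 1 ≃ₗ[R]
      (Ext S.X₁ M 0 ⧸ LinearMap.range ((Ext.mk₀ S.f).precompOfLinear R M (zero_add 0)))) := by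
  have hs : Function.Surjective (hS.extClass.precompOfLinear R M (add_zero 1)) :=
    precomp_extClass_surjective_of_projective_X₂ M hS 0
  exact ⟨(Submodule.quotEquivOfEq _ _
    (exact_precomp₁ hS M (add_zero 1)).linearMap_ker_eq.symm ≪≫ₗ
      LinearMap.quotKerEquivOfSurjective _ hs).symm⟩

include hS in
theorem nonempty_ext_succ_equiv [Projective S.X₂] (n : ℕ) :
    Nonempty (Ext S.X₃ M (n + 2) ≃ₗ[R] Ext S.X₁ M (n + 1)) := by
  have hs : Function.Surjective (hS.extClass.precompOfLinear R M (add_comm 1 (n + 1))) :=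
    precomp_extClass_surjective_of_projective_X₂ M hS (n + 1)
  refine ⟨(LinearEquiv.ofBijective _ ⟨?_, hs⟩).symm⟩
  rw [injective_iff_map_eq_zero]
  intro x hx
  obtain ⟨y, rfl⟩ := (exact_precomp₁ hS M (add_comm 1 (n + 1)) x).1 hx
  rw [Ext.eq_zero_of_projective y, map_zero]

/-- `Ext` of isomorphic modules. -/
noncomputable def extCongrLeft {A B : ModuleCat.{u} R} (e : A ≃ₗ[R] B) (M : ModuleCat.{u} R)
    (n : ℕ) : Ext A M n ≃ₗ[R] Ext B M n :=
  LinearEquiv.ofLinearMap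
    ((Ext.mk₀ e.toModuleIso.inv).precompOfLinear R M (zero_add n))
    ((Ext.mk₀ e.toModuleIso.hom).precompOfLinear R M (zero_add n))
    (by ext x; simp [-LinearEquiv.toModuleIso_inv, -LinearEquiv.toModuleIso_hom])
    (by ext x; simp [-LinearEquiv.toModuleIso_inv, -LinearEquiv.toModuleIso_hom])

/-- `Ext` takes finite powers in the first variable to powers. -/
theorem nonempty_ext_pi_equiv (A M : ModuleCat.{u} R) (r n : ℕ) :
    Nonempty (Ext (ModuleCat.of R (Fin r → A)) M n ≃ₗ[R] (Fin r → Ext A M n)) := by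
  have hι (i j : Fin r) : ModuleCat.ofHom (LinearMap.single R (fun _ : Fin r => A) i) ≫
      ModuleCat.ofHom (LinearMap.proj (R := R) (φ := fun _ : Fin r => A) j) =
        if i = j then 𝟙 A else 0 := by
    split_ifs with h
    · subst h
      ext x
      simp
    · ext x
      simp [Ne.symm h]
  have hsum : ∑ i : Fin r, ModuleCat.ofHom (LinearMap.proj (R := R) (φ := fun _ : Fin r => A) i) ≫
      ModuleCat.ofHom (LinearMap.single R (fun _ : Fin r => A) i) = 𝟙 _ := by
    ext x j
    simp [ModuleCat.hom_sum, Finset.sum_apply, Pi.single_apply]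
  refine ⟨LinearEquiv.ofLinearMap
    (LinearMap.pi fun i => (Ext.mk₀ (ModuleCat.ofHom
      (LinearMap.single R (fun _ : Fin r => A) i))).precompOfLinear R M (zero_add n))
    (∑ i, ((Ext.mk₀ (ModuleCat.ofHom
      (LinearMap.proj (R := R) (φ := fun _ : Fin r => A) i))).precompOfLinear R M
        (zero_add n)).comp (LinearMap.proj i)) ?_ ?_⟩
  · apply LinearMap.ext
    intro x
    ext j
    simp only [LinearMap.comp_apply, LinearMap.pi_apply, LinearMap.sum_apply, map_sum,
      LinearMap.proj_apply, Ext.bilinearCompOfLinear_apply_apply, LinearMap.id_apply]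
    simp only [← Ext.comp_assoc_of_second_deg_zero, Ext.mk₀_comp_mk₀, hι]
    rw [Finset.sum_eq_single j]
    · simp
    · intro i _ hij
      simp [Ne.symm hij]
    · simp
  · apply LinearMap.ext
    intro x
    simp only [LinearMap.comp_apply, LinearMap.pi_apply, LinearMap.sum_apply,
      LinearMap.proj_apply, Ext.bilinearCompOfLinear_apply_apply, LinearMap.id_apply]
    simp only [← Ext.comp_assoc_of_second_deg_zero, Ext.mk₀_comp_mk₀]
    rw [← Ext.sum_comp, ← Ext.mk₀_sum, hsum, Ext.mk₀_id_comp]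

end ExtSequence

/-! ### Evaluation maps `L ⊗ M → Hom(J, M)`. -/

section EvalHom

variable {R : Type u} [CommRing R]
variable {L J J' N P : Type u} [AddCommGroup L] [Module R L] [AddCommGroup J] [Module R J]
  [AddCommGroup J'] [Module R J'] [AddCommGroup N] [Module R N] [AddCommGroup P] [Module R P]
  (M : Type u) [AddCommGroup M] [Module R M]

/-- The map `L ⊗ M → Hom(J, M)`, `x ⊗ m ↦ (f ↦ j(f)(x) m)`, for `j : J → L^*`. -/
noncomputable def evalHom (j : J →ₗ[R] Module.Dual R L) :
    TensorProduct R L M →ₗ[R] (J →ₗ[R] M) :=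
  (dualTensorHom R J M).comp (LinearMap.rTensor M j.flip)

variable {M}

@[simp]
theorem evalHom_tmul (j : J →ₗ[R] Module.Dual R L) (x : L) (m : M) (f : J) :
    evalHom M j (TensorProduct.tmul R x m) f = j f x • m := by
  simp [evalHom]

theorem evalHom_comp (j : J →ₗ[R] Module.Dual R L) (g : J' →ₗ[R] J) (z : TensorProduct R L M) :
    evalHom M (j ∘ₗ g) z = evalHom M j z ∘ₗ g := by
  induction z using TensorProduct.induction_on with
  | zero => simp
  | tmul x m => ext; simp
  | add x y hx hy => rw [map_add, map_add, hx, hy, LinearMap.add_comp]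

theorem evalHom_dualMap_comp (π : P →ₗ[R] L) (j : J →ₗ[R] Module.Dual R L)
    (z : TensorProduct R P M) :
    evalHom M (π.dualMap ∘ₗ j) z = evalHom M j (LinearMap.rTensor M π z) := by
  induction z using TensorProduct.induction_on with
  | zero => simp
  | tmul x m => ext; simp
  | add x y hx hy => rw [map_add, map_add, map_add, hx, hy]

/-- Biduality `P ≅ P^**` followed by `P^** ⊗ M ≅ Hom(P^*, M)`. -/
theorem evalHom_id_bijective [Module.Finite R P] [Module.Projective R P] :
    Function.Bijective (evalHom M (LinearMap.id : Module.Dual R P →ₗ[R] Module.Dual R P)) := by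
  have h : evalHom M (LinearMap.id : Module.Dual R P →ₗ[R] Module.Dual R P) =
      ((TensorProduct.congr (Module.evalEquiv R P) (LinearEquiv.refl R M)).trans
        (dualTensorHomEquiv R (Module.Dual R P) M)).toLinearMap := by
    ext x m f
    simp
  rw [h]
  exact LinearEquiv.bijective _

variable {ι : N →ₗ[R] P} {π : P →ₗ[R] L} {j : J →ₗ[R] Module.Dual R L}
  {j' : J' →ₗ[R] Module.Dual R N} {q : Module.Dual R P →ₗ[R] J'}

theorem exact_dualMap (hιπ : Function.Exact ι π) (hπ : Function.Surjective π) :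
    Function.Exact π.dualMap ι.dualMap :=
  fun f => by
    refine ⟨fun hf => ?_, ?_⟩
    · refine ⟨(LinearMap.ker π).liftQ f ?_ ∘ₗ
        (LinearMap.quotKerEquivOfSurjective π hπ).symm.toLinearMap, ?_⟩
      · intro x hx
        obtain ⟨y, rfl⟩ := (hιπ x).1 hx
        exact LinearMap.congr_fun hf y
      · ext x
        have : (LinearMap.quotKerEquivOfSurjective π hπ).symm (π x) =
            Submodule.Quotient.mk x := by
          rw [LinearEquiv.symm_apply_eq]
          rfl
        simp [this]
    · rintro ⟨g, rfl⟩
      ext x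
      simp [hιπ.apply_apply_eq_zero]

/-- Left exactness of the dual: since `j` is onto `L^*` and `j'` is injective, replacing `L^*` by
`J` and `N^*` by `J'` changes neither the image nor the kernel. -/
theorem exact_dualMap_comp (hιπ : Function.Exact ι π) (hπ : Function.Surjective π)
    (hj : Function.Surjective j) (hj' : Function.Injective j') (hq : j' ∘ₗ q = ι.dualMap) :
    Function.Exact (π.dualMap ∘ₗ j) q := by
  intro f
  rw [LinearMap.coe_comp, hj.range_comp, ← exact_dualMap hιπ hπ f, ← hq, LinearMap.comp_apply,
    map_eq_zero_iff j' hj']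

theorem evalHom_rTensor_eq (hq : j' ∘ₗ q = ι.dualMap) (z : TensorProduct R N M) :
    evalHom M LinearMap.id (LinearMap.rTensor M ι z) = evalHom M j' z ∘ₗ q := by
  rw [← evalHom_dualMap_comp, LinearMap.comp_id, ← hq, evalHom_comp]

/-- As `q` is surjective, `Hom(J', M)` embeds in `Hom(P^*, M) ≅ P ⊗ M`, and there the evaluation map
becomes `ι ⊗ M`. -/
theorem ker_evalHom_eq [Module.Finite R P] [Module.Projective R P]
    (hq : j' ∘ₗ q = ι.dualMap) (hqs : Function.Surjective q) :
    LinearMap.ker (evalHom M j') = LinearMap.ker (LinearMap.rTensor M ι) := by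
  ext z
  rw [LinearMap.mem_ker, LinearMap.mem_ker,
    ← map_eq_zero_iff _ (evalHom_id_bijective (M := M) (P := P)).1, evalHom_rTensor_eq hq,
    ← LinearMap.zero_comp q, LinearMap.cancel_right hqs]

/-- The snake lemma for the evaluation maps of a short exact sequence `N → P → L`
with `P` projective. -/
theorem nonempty_coker_evalHom_equiv [Module.Finite R P] [Module.Projective R P]
    (hιπ : Function.Exact ι π) (hπ : Function.Surjective π)
    (hj : Function.Surjective j) (hj' : Function.Injective j') (hq : j' ∘ₗ q = ι.dualMap)
    (hqs : Function.Surjective q) :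
    Nonempty (((J' →ₗ[R] M) ⧸ LinearMap.range (evalHom M j')) ≃ₗ[R]
      LinearMap.ker (evalHom M j)) := by
  let ev := LinearEquiv.ofBijective _ (evalHom_id_bijective (R := R) (M := M) (P := P))
  have hev (z) : ev z = evalHom M LinearMap.id z := rfl
  -- The connecting map: extend `h` along `q` to `P^*`, read the result as an element of `P ⊗ M`,
  -- and push it to `L ⊗ M`.
  let θ : (J' →ₗ[R] M) →ₗ[R] TensorProduct R L M :=
    (LinearMap.rTensor M π) ∘ₗ ev.symm.toLinearMap ∘ₗ q.lcomp R M
  have hθ (h) : θ h = LinearMap.rTensor M π (ev.symm (h ∘ₗ q)) := rfl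
  have hex := exact_dualMap_comp hιπ hπ hj hj' hq
  have hφ (z : TensorProduct R P M) :
      evalHom M j (LinearMap.rTensor M π z) = ev z ∘ₗ π.dualMap ∘ₗ j := by
    rw [← evalHom_dualMap_comp, hev, ← evalHom_comp, LinearMap.id_comp]
  have hrange : LinearMap.range θ = LinearMap.ker (evalHom M j) := by
    ext z
    constructor
    · rintro ⟨h, rfl⟩
      rw [LinearMap.mem_ker, hθ, hφ, LinearEquiv.apply_symm_apply, LinearMap.comp_assoc,
        hex.linearMap_comp_eq_zero, LinearMap.comp_zero]
    · intro hz
      obtain ⟨y, rfl⟩ := LinearMap.rTensor_surjective M hπ z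
      rw [LinearMap.mem_ker, hφ] at hz
      -- The kernel of `q` is the image of `π^* ∘ j`, where `ev y` vanishes by `hz`; so `ev y`
      -- descends along `q` to a preimage under `θ`.
      have hle : LinearMap.ker q ≤ LinearMap.ker (ev y) := by
        rw [hex.linearMap_ker_eq]
        rintro _ ⟨f, rfl⟩
        exact LinearMap.congr_fun hz f
      refine ⟨(LinearMap.ker q).liftQ (ev y) hle ∘ₗ
        (LinearMap.quotKerEquivOfSurjective q hqs).symm.toLinearMap, ?_⟩
      rw [hθ]
      congr 1
      rw [LinearEquiv.symm_apply_eq]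
      ext x : 1
      have : (LinearMap.quotKerEquivOfSurjective q hqs).symm (q x) =
          Submodule.Quotient.mk x := by
        rw [LinearEquiv.symm_apply_eq]
        rfl
      simp [this]
  have hker : LinearMap.ker θ = LinearMap.range (evalHom M j') := by
    ext h
    rw [LinearMap.mem_ker, hθ, rTensor_exact M hιπ hπ]
    refine exists_congr fun w => ?_
    rw [LinearEquiv.eq_symm_apply, hev, evalHom_rTensor_eq hq, LinearMap.cancel_right hqs]
  exact ⟨Submodule.quotEquivOfEq _ _ hker.symm ≪≫ₗ θ.quotKerEquivRange ≪≫ₗ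
    LinearEquiv.ofEq _ _ hrange⟩

end EvalHom

/-! ### Evaluation maps and `Ext` of a cokernel. -/

section ExtEval

variable {R : Type u} [CommRing R] {L Q : Type u} [AddCommGroup L] [Module R L]
  [AddCommGroup Q] [Module R Q] (J T M : ModuleCat.{u} R)

/-- The map `L ⊗ M → Ext⁰(J, M)` given by `evalHom`. -/
noncomputable def evalExt (j : J →ₗ[R] Module.Dual R L) :
    TensorProduct R L M →ₗ[R] Ext J M 0 :=
  (extZeroEquiv J M).symm.toLinearMap ∘ₗ evalHom M j

variable {J T M}

theorem ker_evalExt (j : J →ₗ[R] Module.Dual R L) :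
    LinearMap.ker (evalExt J M j) = LinearMap.ker (evalHom M j) := by
  ext; simp [evalExt]

theorem nonempty_coker_evalExt_equiv (j : J →ₗ[R] Module.Dual R L) :
    Nonempty ((Ext J M 0 ⧸ LinearMap.range (evalExt J M j)) ≃ₗ[R]
      ((J →ₗ[R] M) ⧸ LinearMap.range (evalHom M j))) :=
  ⟨Submodule.Quotient.equiv _ _ (extZeroEquiv J M) (by
    rw [evalExt, LinearMap.range_comp, ← Submodule.map_comp]
    simp)⟩

variable [Module.Finite R Q] [Module.Projective R Q] {π : Q →ₗ[R] L}

theorem range_precomp_dualMap_comp (hπ : Function.Surjective π) (j : J →ₗ[R] Module.Dual R L) :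
    LinearMap.range ((Ext.mk₀ (ModuleCat.ofHom (π.dualMap ∘ₗ j) :
      J ⟶ ModuleCat.of R (Module.Dual R Q))).precompOfLinear R M (zero_add 0)) =
      LinearMap.range (evalExt J M j) := by
  have h (y : TensorProduct R Q M) : (Ext.mk₀ (ModuleCat.ofHom (π.dualMap ∘ₗ j) :
      J ⟶ ModuleCat.of R (Module.Dual R Q))).precompOfLinear R M (zero_add 0)
        ((extZeroEquiv (ModuleCat.of R (Module.Dual R Q)) M).symm (evalHom M LinearMap.id y)) =
      evalExt J M j (LinearMap.rTensor M π y) := by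
    apply (extZeroEquiv J M).injective
    rw [extZeroEquiv_precomp, LinearEquiv.apply_symm_apply]
    have h₁ : evalHom M LinearMap.id y ∘ₗ (π.dualMap ∘ₗ j) =
        evalHom M j (LinearMap.rTensor M π y) := by
      rw [← evalHom_comp, LinearMap.id_comp, evalHom_dualMap_comp]
    have h₂ : extZeroEquiv J M (evalExt J M j (LinearMap.rTensor M π y)) =
        evalHom M j (LinearMap.rTensor M π y) := (extZeroEquiv J M).apply_symm_apply _
    exact h₁.trans h₂.symm
  apply le_antisymm
  · rintro _ ⟨x, rfl⟩
    obtain ⟨y, rfl⟩ := (extZeroEquiv (ModuleCat.of R (Module.Dual R Q)) M).symm.surjective x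
    obtain ⟨z, rfl⟩ := (evalHom_id_bijective (R := R) (M := M) (P := Q)).2 y
    exact ⟨_, (h z).symm⟩
  · rintro _ ⟨z, rfl⟩
    obtain ⟨y, rfl⟩ := LinearMap.rTensor_surjective M hπ z
    exact ⟨_, h y⟩

variable {j : J →ₗ[R] Module.Dual R L} {p : Module.Dual R Q →ₗ[R] T}
  (hπ : Function.Surjective π) (hj : Function.Injective j)
  (hjp : Function.Exact (π.dualMap ∘ₗ j) p) (hp : Function.Surjective p)

include hπ hj hjp hp

/-- In `0 → J → Q^* → T → 0` the middle term is projective, so `Ext^1(T, M)` is the cokernel of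
`Hom(Q^*, M) → Hom(J, M)`. Since `Hom(Q^*, M) ≅ Q ⊗ M` surjects onto `L ⊗ M`, the image is that of
the evaluation map. -/
theorem nonempty_ext_one_equiv_coker_evalExt :
    Nonempty (Ext T M 1 ≃ₗ[R] (Ext J M 0 ⧸ LinearMap.range (evalExt J M j))) := by
  let S : ShortComplex (ModuleCat.{u} R) := ShortComplex.mk (X₁ := J)
    (X₂ := ModuleCat.of R (Module.Dual R Q)) (X₃ := T)
    (ModuleCat.ofHom (π.dualMap ∘ₗ j)) (ModuleCat.ofHom p)
    (by ext x; exact hjp.apply_apply_eq_zero x)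
  have hS : S.ShortExact := ModuleCat.shortComplex_shortExact S hjp
    ((LinearMap.dualMap_injective_of_surjective hπ).comp hj) hp
  have : Projective S.X₂ :=
    (IsProjective.iff_projective (Module.Dual R Q)).1 inferInstance
  obtain ⟨e⟩ := nonempty_ext_one_equiv hS M
  exact ⟨e ≪≫ₗ Submodule.quotEquivOfEq _ _ (range_precomp_dualMap_comp hπ j)⟩

theorem nonempty_ext_succ_equiv_of_dual (n : ℕ) :
    Nonempty (Ext T M (n + 2) ≃ₗ[R] Ext J M (n + 1)) := by
  let S : ShortComplex (ModuleCat.{u} R) := ShortComplex.mk (X₁ := J)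
    (X₂ := ModuleCat.of R (Module.Dual R Q)) (X₃ := T)
    (ModuleCat.ofHom (π.dualMap ∘ₗ j)) (ModuleCat.ofHom p)
    (by ext x; exact hjp.apply_apply_eq_zero x)
  have hS : S.ShortExact := ModuleCat.shortComplex_shortExact S hjp
    ((LinearMap.dualMap_injective_of_surjective hπ).comp hj) hp
  have : Projective S.X₂ :=
    (IsProjective.iff_projective (Module.Dual R Q)).1 inferInstance
  exact nonempty_ext_succ_equiv hS M n

end ExtEval

/-! ### Splicing a map into a long exact sequence. -/

section Splice

variable {R : Type u} [CommRing R] {V : Type u} [AddCommGroup V] [Module R V]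

/-- The sequence `Ker ψ, Coker ψ, H 1, H 2, …` for a map `ψ : V → H 0`. -/
noncomputable def spliceObj (H : ℕ → ModuleCat.{u} R) (ψ : V →ₗ[R] H 0) : ℕ → ModuleCat.{u} R
  | 0 => ModuleCat.of R (LinearMap.ker ψ)
  | 1 => ModuleCat.of R (H 0 ⧸ LinearMap.range ψ)
  | n + 2 => H (n + 1)

/-- A long exact sequence `0 → X 0 → H 0 → G 0 → X 1 → ⋯` and a map `ψ : V → H 0` give a long
exact sequence `0 → Ker ψ → Ker (ρ ∘ ψ) → X 0 → Coker ψ → Coker (ρ ∘ ψ) → X 1 → H 1 → ⋯`. -/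
theorem exists_splice_exact {X H G : ℕ → ModuleCat.{u} R} (ψ : V →ₗ[R] H 0)
    (χ : ∀ n, X n →ₗ[R] H n) (ρ : ∀ n, H n →ₗ[R] G n) (δ : ∀ n, G n →ₗ[R] X (n + 1))
    (hχ : Function.Injective (χ 0)) (hχρ : ∀ n, Function.Exact (χ n) (ρ n))
    (hρδ : ∀ n, Function.Exact (ρ n) (δ n)) (hδχ : ∀ n, Function.Exact (δ n) (χ (n + 1))) :
    ∃ (a : ∀ n, spliceObj H ψ n →ₗ[R] spliceObj G (ρ 0 ∘ₗ ψ) n)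
      (b : ∀ n, spliceObj G (ρ 0 ∘ₗ ψ) n →ₗ[R] X n)
      (c : ∀ n, X n →ₗ[R] spliceObj H ψ (n + 1)),
      Function.Injective (a 0) ∧ (∀ n, Function.Exact (a n) (b n)) ∧
        (∀ n, Function.Exact (b n) (c n)) ∧ ∀ n, Function.Exact (c n) (a (n + 1)) := by
  let e := LinearEquiv.ofInjective (χ 0) hχ
  let b₀ : LinearMap.ker (ρ 0 ∘ₗ ψ) →ₗ[R] X 0 := e.symm.toLinearMap ∘ₗ
    (ψ ∘ₗ (LinearMap.ker (ρ 0 ∘ₗ ψ)).subtype).codRestrict (LinearMap.range (χ 0))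
      (fun z => (hχρ 0 _).1 z.2)
  have hb₀ (z) : χ 0 (b₀ z) = ψ z.1 := congrArg Subtype.val (e.apply_symm_apply _)
  let a : ∀ n, spliceObj H ψ n →ₗ[R] spliceObj G (ρ 0 ∘ₗ ψ) n := fun
    | 0 => Submodule.inclusion (LinearMap.ker_le_ker_comp ψ (ρ 0))
    | 1 => Submodule.mapQ _ _ (ρ 0) (by rw [LinearMap.range_comp]; exact Submodule.le_comap_map _ _)
    | n + 2 => ρ (n + 1)
  let b : ∀ n, spliceObj G (ρ 0 ∘ₗ ψ) n →ₗ[R] X n := fun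
    | 0 => b₀
    | 1 => Submodule.liftQ _ (δ 0) (by
        rintro _ ⟨z, rfl⟩
        exact (hρδ 0).apply_apply_eq_zero (ψ z))
    | n + 2 => δ (n + 1)
  let c : ∀ n, X n →ₗ[R] spliceObj H ψ (n + 1) := fun
    | 0 => (LinearMap.range ψ).mkQ ∘ₗ χ 0
    | n + 1 => χ (n + 1)
  refine ⟨a, b, c, Submodule.inclusion_injective _, ?_, ?_, ?_⟩
  · rintro (_ | _ | n)
    · intro (z : LinearMap.ker (ρ 0 ∘ₗ ψ))
      change b₀ z = 0 ↔ _
      rw [← map_eq_zero_iff (χ 0) hχ, hb₀]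
      exact ⟨fun h => ⟨⟨z.1, h⟩, rfl⟩, by rintro ⟨y, rfl⟩; exact y.2⟩
    · intro y
      obtain ⟨y, rfl⟩ := Submodule.mkQ_surjective _ y
      change δ 0 y = 0 ↔ _
      rw [hρδ 0]
      constructor
      · rintro ⟨x, rfl⟩
        exact ⟨Submodule.Quotient.mk x, rfl⟩
      · rintro ⟨x, hx⟩
        obtain ⟨x, rfl⟩ := Submodule.mkQ_surjective _ x
        obtain ⟨z, hz⟩ := (Submodule.Quotient.eq _).1
          (show Submodule.Quotient.mk (ρ 0 x) = Submodule.Quotient.mk y from hx)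
        -- `ρ x` and `y` agree only modulo the image of `ρ ∘ ψ`; correcting `x` by `ψ z` makes them
        -- equal.
        refine ⟨x - ψ z, ?_⟩
        rw [map_sub]
        exact (congrArg (ρ 0 x - ·) hz).trans (sub_sub_cancel _ _)
    · exact hρδ (n + 1)
  · rintro (_ | _ | n)
    · intro x
      change Submodule.Quotient.mk (χ 0 x) = 0 ↔ _
      rw [Submodule.Quotient.mk_eq_zero]
      constructor
      · rintro ⟨z, hz⟩
        have hz' : z ∈ LinearMap.ker (ρ 0 ∘ₗ ψ) := by
          rw [LinearMap.mem_ker, LinearMap.comp_apply, hz]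
          exact (hχρ 0).apply_apply_eq_zero x
        exact ⟨(⟨z, hz'⟩ : LinearMap.ker (ρ 0 ∘ₗ ψ)), hχ ((hb₀ ⟨z, hz'⟩).trans hz)⟩
      · rintro ⟨z, rfl⟩
        exact ⟨z.1, (hb₀ z).symm⟩
    · intro x
      refine (hδχ 0 x).trans ⟨?_, ?_⟩
      · rintro ⟨y, rfl⟩
        exact ⟨Submodule.Quotient.mk y, rfl⟩
      · rintro ⟨y, rfl⟩
        obtain ⟨y, rfl⟩ := Submodule.mkQ_surjective _ y
        exact ⟨y, rfl⟩
    · exact hδχ (n + 1)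
  · rintro (_ | n)
    · intro y
      obtain ⟨y, rfl⟩ := Submodule.mkQ_surjective _ y
      change Submodule.Quotient.mk (ρ 0 y) = 0 ↔ _
      rw [Submodule.Quotient.mk_eq_zero]
      constructor
      · rintro ⟨z, hz⟩
        obtain ⟨x, hx⟩ := (hχρ 0 (y - ψ z)).1 (by
          rw [map_sub, sub_eq_zero]; exact hz.symm)
        refine ⟨x, (Submodule.Quotient.eq _).2 ⟨-z, ?_⟩⟩
        rw [hx, map_neg]
        abel
      · rintro ⟨x, hx⟩
        obtain ⟨z, hz⟩ := (Submodule.Quotient.eq _).1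
          (show Submodule.Quotient.mk (χ 0 x) = Submodule.Quotient.mk y from hx)
        refine ⟨-z, ?_⟩
        rw [map_neg, LinearMap.comp_apply, hz, map_sub, (hχρ 0).apply_apply_eq_zero]
        simp
    · exact hχρ (n + 1)

end Splice

/-! ### Syzygies as kernels of projective covers by short exact sequences. -/

section Syzygies

variable {R : Type u} [CommRing R]

theorem IsSyzygy.exists_exact {n : ℕ} {K N : ModuleCat.{u} R} (h : IsSyzygy (n + 1) K N) :
    ∃ L : ModuleCat.{u} R, IsSyzygy n K L ∧ ∃ (P : ModuleCat.{u} R)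
      (_ : Module.Finite R P) (_ : Module.Projective R P) (ι : N →ₗ[R] P) (π : P →ₗ[R] L),
      Function.Injective ι ∧ Function.Exact ι π ∧ Function.Surjective π := by
  obtain ⟨L, hL, P, ⟨e⟩⟩ := h
  refine ⟨L, hL, P.P₀, P.finite₀, P.projective₀,
    (LinearMap.range P.d).subtype ∘ₗ e.toLinearMap, P.ε,
    (Submodule.subtype_injective _).comp e.injective, fun x => ?_, P.surjective⟩
  rw [P.exact x, LinearMap.coe_comp, LinearEquiv.coe_coe, e.surjective.range_comp]
  simp

variable {N P L : ModuleCat.{u} R} {ι : N →ₗ[R] P} {π : P →ₗ[R] L}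

/-- The short complex in `ModuleCat R` attached to an exact pair of linear maps. -/
abbrev exactShortComplex (hιπ : Function.Exact ι π) : ShortComplex (ModuleCat.{u} R) :=
  ShortComplex.mk (ModuleCat.ofHom ι) (ModuleCat.ofHom π)
    (by ext x; exact hιπ.apply_apply_eq_zero x)

variable (hι : Function.Injective ι) (hιπ : Function.Exact ι π) (hπ : Function.Surjective π)
include hι hπ

theorem exactShortComplex_shortExact : (exactShortComplex hιπ).ShortExact :=
  ModuleCat.shortComplex_shortExact (exactShortComplex hιπ) hιπ hι hπ

include hιπ

theorem nonempty_dual_quotient_equiv [Module.Projective R P] :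
    Nonempty ((Module.Dual R N ⧸ LinearMap.range ι.dualMap) ≃ₗ[R]
      Ext L (ModuleCat.of R R) 1) := by
  have : Projective (exactShortComplex hιπ).X₂ := (IsProjective.iff_projective P).1 inferInstance
  obtain ⟨e⟩ := nonempty_ext_one_equiv (exactShortComplex_shortExact hι hιπ hπ)
    (ModuleCat.of R R)
  refine ⟨(e ≪≫ₗ Submodule.Quotient.equiv _ _ (extZeroEquiv N (ModuleCat.of R R)) ?_).symm⟩
  have h (x : Ext P (ModuleCat.of R R) 0) : extZeroEquiv N (ModuleCat.of R R)
      ((Ext.mk₀ (ModuleCat.ofHom ι)).precompOfLinear R (ModuleCat.of R R) (zero_add 0) x) =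
        ι.dualMap (extZeroEquiv P (ModuleCat.of R R) x) := extZeroEquiv_precomp _ x
  apply le_antisymm
  · rintro _ ⟨_, ⟨x, rfl⟩, rfl⟩
    exact ⟨_, (h x).symm⟩
  · rintro _ ⟨f, rfl⟩
    refine ⟨_, ⟨(extZeroEquiv P (ModuleCat.of R R)).symm f, rfl⟩, (h _).trans ?_⟩
    rw [LinearEquiv.apply_symm_apply]

end Syzygies

/-! ### Shifting `Ext` and `Tor` along iterated syzygies. -/

section SyzygyShift

variable {R : Type u} [CommRing R]

theorem IsSyzygy.nonempty_ext_equiv {n : ℕ} {K L : ModuleCat.{u} R} (h : IsSyzygy n K L)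
    (M : ModuleCat.{u} R) (i : ℕ) :
    Nonempty (Ext L M (i + 1) ≃ₗ[R] Ext K M (n + i + 1)) := by
  induction n generalizing L i with
  | zero =>
    obtain ⟨e⟩ := h
    rw [zero_add]
    exact ⟨extCongrLeft e M _⟩
  | succ n ih =>
    obtain ⟨L', hL', P, _, _, ι, π, hι, hιπ, hπ⟩ := h.exists_exact
    have : Projective (exactShortComplex hιπ).X₂ := (IsProjective.iff_projective P).1 inferInstance
    obtain ⟨e⟩ := nonempty_ext_succ_equiv (exactShortComplex_shortExact hι hιπ hπ) M i
    obtain ⟨e'⟩ := ih hL' (i + 1)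
    rw [show n + 1 + i + 1 = n + (i + 1) + 1 by omega]
    exact ⟨e.symm ≪≫ₗ e'⟩

theorem IsSyzygy.nonempty_tor_equiv {n : ℕ} {K L : ModuleCat.{u} R} (h : IsSyzygy n K L)
    (M : ModuleCat.{u} R) (i : ℕ) :
    Nonempty (((Tor (ModuleCat.{u} R) (i + 1)).obj L).obj M ≃ₗ[R]
      ((Tor (ModuleCat.{u} R) (n + i + 1)).obj K).obj M) := by
  induction n generalizing L i with
  | zero =>
    obtain ⟨e⟩ := h
    rw [zero_add]
    exact ⟨(((Tor (ModuleCat.{u} R) (i + 1)).mapIso e.toModuleIso).app M).toLinearEquiv⟩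
  | succ n ih =>
    obtain ⟨L', hL', P, _, _, ι, π, hι, hιπ, hπ⟩ := h.exists_exact
    have : Module.Flat R (exactShortComplex hιπ).X₂ := inferInstanceAs (Module.Flat R P)
    obtain ⟨e⟩ := nonempty_tor_succ_iso (exactShortComplex_shortExact hι hιπ hπ) M i
    obtain ⟨e'⟩ := ih hL' (i + 1)
    rw [show n + 1 + i + 1 = n + (i + 1) + 1 by omega]
    exact ⟨e.symm.toLinearEquiv ≪≫ₗ e'⟩

end SyzygyShift

/-! ### The induction along the syzygies of `k`. -/

section Tower

variable {R : Type u} [CommRing R] [IsLocalRing R]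

/-- `Tor_{n - i}(k, M)` for `i ≤ n`, and zero otherwise. -/
noncomputable def torOrZero (M : ModuleCat.{u} R) (n i : ℕ) : ModuleCat.{u} R :=
  if i ≤ n then ((Tor (ModuleCat.{u} R) (n - i)).obj (resField R)).obj M
  else ModuleCat.of R PUnit

theorem torOrZero_of_le (M : ModuleCat.{u} R) {n i : ℕ} (h : i ≤ n) :
    torOrZero M n i = ((Tor (ModuleCat.{u} R) (n - i)).obj (resField R)).obj M := if_pos h

theorem torOrZero_zero (M : ModuleCat.{u} R) (n : ℕ) :
    torOrZero M n 0 = ((Tor (ModuleCat.{u} R) n).obj (resField R)).obj M := if_pos n.zero_le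

theorem torOrZero_succ (M : ModuleCat.{u} R) (n i : ℕ) :
    torOrZero M (n + 1) (i + 1) = torOrZero M n i := by
  simp [torOrZero]

theorem subsingleton_torOrZero (M : ModuleCat.{u} R) {n i : ℕ} (h : n < i) :
    Subsingleton (torOrZero M n i) := by
  rw [torOrZero, if_neg (not_le.2 h)]
  infer_instance

/-- For `L = Ω^n k`, the map `j : I → L^*` behaves like the inclusion of the image of
`P_{n-1}^* → L^*`, where `P` is the projective resolution of `k` defining `L`. -/
structure IsDualImage (M : ModuleCat.{u} R) (n : ℕ) (L I : ModuleCat.{u} R)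
    (j : I →ₗ[R] Module.Dual R L) : Prop where
  injective : Function.Injective j
  coker : Nonempty ((Module.Dual R L ⧸ LinearMap.range j) ≃ₗ[R]
    Ext (resField R) (ModuleCat.of R R) n)
  splice : ∀ i, Nonempty (spliceObj (fun i => Ext I M i |> ModuleCat.of R) (evalExt I M j) i ≃ₗ[R]
    torOrZero M n i)

variable {M : ModuleCat.{u} R}

theorem isDualImage_zero (M : ModuleCat.{u} R) {L : ModuleCat.{u} R} (e : L ≃ₗ[R] resField R) :
    IsDualImage M 0 L (ModuleCat.of R PUnit) 0 where
  injective := Function.injective_of_subsingleton _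
  coker := ⟨Submodule.quotEquivOfEqBot _ LinearMap.range_zero ≪≫ₗ
    (extZeroEquiv L (ModuleCat.of R R)).symm ≪≫ₗ extCongrLeft e _ 0⟩
  splice := by
    have : Projective (ModuleCat.of R PUnit.{u + 1}) :=
      (IsProjective.iff_projective PUnit).1 inferInstance
    have h0 : Subsingleton (Ext (ModuleCat.of R PUnit.{u + 1}) M 0) :=
      (extZeroEquiv _ _).toEquiv.subsingleton
    rintro (_ | _ | i)
    · rw [torOrZero_zero]
      have : LinearMap.ker (evalExt (ModuleCat.of R PUnit.{u + 1}) M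
          (0 : _ →ₗ[R] Module.Dual R L)) = ⊤ := by
        ext x
        simpa using Subsingleton.elim _ _
      exact ⟨LinearEquiv.ofEq _ _ this ≪≫ₗ Submodule.topEquiv ≪≫ₗ
        TensorProduct.congr e (LinearEquiv.refl R M) ≪≫ₗ (torZeroEquiv _ _).symm⟩
    · have := subsingleton_torOrZero M (Nat.zero_lt_succ 0)
      have h : Subsingleton (spliceObj (fun i => ModuleCat.of R (Ext (ModuleCat.of R PUnit.{u+1}) M i))
        (evalExt (ModuleCat.of R PUnit.{u + 1}) M (0 : _ →ₗ[R] Module.Dual R L)) 1) :=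
        (Submodule.mkQ_surjective _).subsingleton
      exact ⟨0⟩
    · have := subsingleton_torOrZero M (Nat.zero_lt_succ (i + 1))
      have h : Subsingleton (spliceObj (fun i => ModuleCat.of R (Ext (ModuleCat.of R PUnit.{u+1}) M i))
        (evalExt (ModuleCat.of R PUnit.{u + 1}) M (0 : _ →ₗ[R] Module.Dual R L)) (i + 2)) :=
        Ext.subsingleton_of_projective _ _ i
      exact ⟨0⟩

variable {n : ℕ} {N P L I : ModuleCat.{u} R} {ι : N →ₗ[R] P} {π : P →ₗ[R] L}
  {j : I →ₗ[R] Module.Dual R L}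

/-- Passing from `L` to its syzygy `N` prepends one `Tor` to the list and shifts the rest. The new
kernel is `Tor₁(L, M)`; the new cokernel is the old kernel by the snake lemma; and `0 → I → P^* → I'
→ 0`, with `I'` the image of `P^*` in `N^*`, turns the old cokernel and higher `Ext` into `Ext` of
`I'` one degree up. -/
theorem IsDualImage.succ [Module.Finite R P] [Module.Projective R P]
    (h : IsDualImage M n L I j)
    (hι : Function.Injective ι) (hιπ : Function.Exact ι π) (hπ : Function.Surjective π)
    (hn : Subsingleton (Ext (resField R) (ModuleCat.of R R) n))
    (hExt : Nonempty (Ext L (ModuleCat.of R R) 1 ≃ₗ[R]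
      Ext (resField R) (ModuleCat.of R R) (n + 1)))
    (hTor : Nonempty (((Tor (ModuleCat.{u} R) 1).obj L).obj M ≃ₗ[R]
      ((Tor (ModuleCat.{u} R) (n + 1)).obj (resField R)).obj M)) :
    IsDualImage M (n + 1) N (ModuleCat.of R (LinearMap.range ι.dualMap))
      (LinearMap.range ι.dualMap).subtype where
  injective := Submodule.subtype_injective _
  coker := by
    obtain ⟨e⟩ := nonempty_dual_quotient_equiv hι hιπ hπ
    obtain ⟨e'⟩ := hExt
    exact ⟨Submodule.quotEquivOfEq _ _ (Submodule.range_subtype _) ≪≫ₗ e ≪≫ₗ e'⟩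
  splice := by
    have hq : (LinearMap.range ι.dualMap).subtype ∘ₗ ι.dualMap.rangeRestrict = ι.dualMap := rfl
    have hqs := ι.dualMap.surjective_rangeRestrict
    -- The cokernel of `j` is `Ext^n(k, R) = 0`, so `I` is all of `L^*`. Vanishing is needed in
    -- degree `n` but not `n + 1`, so the induction reaches `t` itself.
    have hj : Function.Surjective j := by
      obtain ⟨e⟩ := h.coker
      rw [← LinearMap.range_eq_top, ← Submodule.Quotient.subsingleton_iff]
      exact e.toEquiv.subsingleton
    have hex := exact_dualMap_comp (J' := LinearMap.range ι.dualMap)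
      (j' := (LinearMap.range ι.dualMap).subtype) (q := ι.dualMap.rangeRestrict) hιπ hπ hj
      (Submodule.subtype_injective _) hq
    rintro (_ | _ | i)
    · rw [torOrZero_zero]
      obtain ⟨e⟩ := hTor
      have : Module.Flat R (exactShortComplex hιπ).X₂ := inferInstanceAs (Module.Flat R P)
      obtain ⟨e'⟩ := nonempty_tor_one_iso (exactShortComplex_shortExact hι hιπ hπ) M
      refine ⟨LinearEquiv.ofEq _ _ ?_ ≪≫ₗ e'.symm ≪≫ₗ e⟩
      exact (ker_evalExt _).trans (ker_evalHom_eq hq hqs)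
    · rw [torOrZero_succ]
      obtain ⟨e₁⟩ := nonempty_coker_evalExt_equiv (M := M)
        (J := ModuleCat.of R (LinearMap.range ι.dualMap)) (LinearMap.range ι.dualMap).subtype
      obtain ⟨e₂⟩ := nonempty_coker_evalHom_equiv (M := M) (J' := LinearMap.range ι.dualMap)
        (j' := (LinearMap.range ι.dualMap).subtype) (q := ι.dualMap.rangeRestrict) hιπ hπ hj
        (Submodule.subtype_injective _) hq hqs
      obtain ⟨e₃⟩ := h.splice 0
      exact ⟨e₁ ≪≫ₗ e₂ ≪≫ₗ LinearEquiv.ofEq _ _ (ker_evalExt j).symm ≪≫ₗ e₃⟩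
    · rw [torOrZero_succ]
      obtain ⟨e⟩ := h.splice (i + 1)
      cases i with
      | zero =>
        obtain ⟨e'⟩ := nonempty_ext_one_equiv_coker_evalExt (M := M)
          (T := ModuleCat.of R (LinearMap.range ι.dualMap)) hπ h.injective hex hqs
        exact ⟨e' ≪≫ₗ e⟩
      | succ i =>
        obtain ⟨e'⟩ := nonempty_ext_succ_equiv_of_dual (M := M)
          (T := ModuleCat.of R (LinearMap.range ι.dualMap)) hπ h.injective hex hqs i
        exact ⟨e' ≪≫ₗ e⟩

theorem IsSyzygy.exists_isDualImage {t : ℕ}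
    (hR : ∀ i < t, Subsingleton (Ext (resField R) (ModuleCat.of R R) i))
    (M : ModuleCat.{u} R) {n : ℕ} (hn : n ≤ t) {L : ModuleCat.{u} R}
    (h : IsSyzygy n (resField R) L) :
    ∃ (I : ModuleCat.{u} R) (j : I →ₗ[R] Module.Dual R L), IsDualImage M n L I j := by
  induction n generalizing L with
  | zero =>
    obtain ⟨e⟩ := h
    exact ⟨_, _, isDualImage_zero M e⟩
  | succ n ih =>
    obtain ⟨L', hL', P, _, _, ι, π, hι, hιπ, hπ⟩ := h.exists_exact
    obtain ⟨I, j, hj⟩ := ih (by omega) hL'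
    exact ⟨_, _, hj.succ hι hιπ hπ (hR n (by omega)) (hL'.nonempty_ext_equiv _ 0)
      (hL'.nonempty_tor_equiv M 0)⟩

end Tower

/-! ### `Ext` of the transpose. -/

section Transpose

variable {R : Type u} [CommRing R] {N P Q S T : ModuleCat.{u} R}

/-- Break `0 → S^* → P^* → Q^* → T → 0` at the image `W` of `P^*` in `N^*`. Two dimension shifts
reduce to `S^*`; in the lowest degree the cokernel for `W` is the kernel for `S^*` by the snake
lemma. -/
theorem nonempty_ext_equiv_of_presentation [Module.Finite R P] [Module.Projective R P]
    [Module.Finite R Q] [Module.Projective R Q] {ι : N →ₗ[R] P} {π : P →ₗ[R] S} {δ : Q →ₗ[R] N}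
    {p : Module.Dual R Q →ₗ[R] T} (hιπ : Function.Exact ι π) (hπ : Function.Surjective π)
    (hδ : Function.Surjective δ) (hp : Function.Exact (ι ∘ₗ δ).dualMap p)
    (hps : Function.Surjective p) (M : ModuleCat.{u} R) (n : ℕ) :
    Nonempty (Ext T M (n + 1) ≃ₗ[R]
      spliceObj (fun i => ModuleCat.of R (Ext (ModuleCat.of R (Module.Dual R S)) M i))
        (evalExt (ModuleCat.of R (Module.Dual R S)) M
          (LinearMap.id : Module.Dual R S →ₗ[R] Module.Dual R S)) n) := by
  obtain ⟨W, w, q, hw, hq, hqs⟩ : ∃ (W : ModuleCat.{u} R) (w : W →ₗ[R] Module.Dual R N)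
      (q : Module.Dual R P →ₗ[R] W), Function.Injective w ∧ w ∘ₗ q = ι.dualMap ∧
        Function.Surjective q :=
    ⟨ModuleCat.of R (LinearMap.range ι.dualMap), (LinearMap.range ι.dualMap).subtype,
      ι.dualMap.rangeRestrict, Submodule.subtype_injective _, rfl,
      ι.dualMap.surjective_rangeRestrict⟩
  have hid : Function.Bijective (LinearMap.id : Module.Dual R S →ₗ[R] Module.Dual R S) :=
    Function.bijective_id
  have hWp : Function.Exact (δ.dualMap ∘ₗ w) p := by
    intro f
    refine (hp f).trans ⟨?_, ?_⟩
    · rintro ⟨g, rfl⟩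
      exact ⟨q g, congrArg δ.dualMap (LinearMap.congr_fun hq g)⟩
    · rintro ⟨g, rfl⟩
      obtain ⟨g, rfl⟩ := hqs g
      exact ⟨g, (congrArg δ.dualMap (LinearMap.congr_fun hq g)).symm⟩
  have hex : Function.Exact (π.dualMap ∘ₗ LinearMap.id) q :=
    exact_dualMap_comp (N := N) (J' := W) (j' := w) (q := q) hιπ hπ hid.2 hw hq
  match n with
  | 0 =>
    obtain ⟨e₁⟩ := nonempty_ext_one_equiv_coker_evalExt (M := M) hδ hw hWp hps
    obtain ⟨e₂⟩ := nonempty_coker_evalExt_equiv (M := M) w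
    obtain ⟨e₃⟩ := nonempty_coker_evalHom_equiv (M := M) hιπ hπ hid.2 hw hq hqs
    let e₄ := LinearEquiv.ofEq _ _ (ker_evalExt (J := ModuleCat.of R (Module.Dual R S)) (M := M)
      (LinearMap.id : Module.Dual R S →ₗ[R] Module.Dual R S)).symm
    exact ⟨(e₁ ≪≫ₗ e₂ ≪≫ₗ e₃).trans e₄⟩
  | 1 =>
    obtain ⟨e₁⟩ := nonempty_ext_succ_equiv_of_dual (M := M) hδ hw hWp hps 0
    obtain ⟨e₂⟩ := nonempty_ext_one_equiv_coker_evalExt (M := M)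
      (J := ModuleCat.of R (Module.Dual R S)) (T := W) hπ hid.1 hex hqs
    exact ⟨e₁ ≪≫ₗ e₂⟩
  | n + 2 =>
    obtain ⟨e₁⟩ := nonempty_ext_succ_equiv_of_dual (M := M) hδ hw hWp hps (n + 1)
    obtain ⟨e₂⟩ := nonempty_ext_succ_equiv_of_dual (M := M)
      (J := ModuleCat.of R (Module.Dual R S)) (T := W) hπ hid.1 hex hqs n
    exact ⟨e₁ ≪≫ₗ e₂⟩

theorem IsTranspose.nonempty_ext_equiv (hT : IsTranspose S T) (M : ModuleCat.{u} R) (n : ℕ) :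
    Nonempty (Ext T M (n + 1) ≃ₗ[R]
      spliceObj (fun i => ModuleCat.of R (Ext (ModuleCat.of R (Module.Dual R S)) M i))
        (evalExt (ModuleCat.of R (Module.Dual R S)) M
          (LinearMap.id : Module.Dual R S →ₗ[R] Module.Dual R S)) n) := by
  obtain ⟨P, ⟨e⟩⟩ := hT
  have := P.finite₀
  have := P.finite₁
  have := P.projective₀
  have := P.projective₁
  refine nonempty_ext_equiv_of_presentation (N := ModuleCat.of R (LinearMap.range P.d))
    (ι := (LinearMap.range P.d).subtype) (π := P.ε) (δ := P.d.rangeRestrict)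
    (p := e.symm.toLinearMap ∘ₗ (LinearMap.range P.d.dualMap).mkQ)
    (fun x => (P.exact x).trans (by simp)) P.surjective P.d.surjective_rangeRestrict ?_
    (e.symm.surjective.comp (Submodule.mkQ_surjective _)) M n
  intro f
  rw [LinearMap.comp_apply, LinearEquiv.coe_coe, LinearEquiv.map_eq_zero_iff]
  exact LinearMap.exact_map_mkQ_range P.d.dualMap f

theorem precomp_evalExt {L : Type u} [AddCommGroup L] [Module R L] {I J M : ModuleCat.{u} R}
    (j : J →ₗ[R] Module.Dual R L) (g : I →ₗ[R] J) :
    (Ext.mk₀ (ModuleCat.ofHom g)).precompOfLinear R M (zero_add 0) ∘ₗ evalExt J M j =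
      evalExt I M (j ∘ₗ g) := by
  apply LinearMap.ext
  intro z
  apply (extZeroEquiv I M).injective
  rw [LinearMap.comp_apply, extZeroEquiv_precomp]
  exact (congrArg (· ∘ₗ g) ((extZeroEquiv J M).apply_symm_apply _)).trans
    ((evalHom_comp j g z).symm.trans ((extZeroEquiv I M).apply_symm_apply _).symm)

end Transpose

/-! ### The long exact sequence. -/

section LongExact

variable {R : Type u} [CommRing R] [IsLocalRing R] {S T I : ModuleCat.{u} R}
  {j : I →ₗ[R] Module.Dual R S}

/-- The long exact sequence relating `Ext(Tr Ω^t k, M)`, `Tor(k, M)` and `Ext(X, M)`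
for `X = Ext^t(k, R)`. -/
theorem IsDualImage.exists_long_exact {M : ModuleCat.{u} R} {t : ℕ} (h : IsDualImage M t S I j)
    (hT : IsTranspose S T) :
    ∃ (X : ModuleCat.{u} R) (_ : Nonempty (X ≃ₗ[R] Ext (resField R) (ModuleCat.of R R) t))
      (a : ∀ n, Ext T M (n + 1) →ₗ[R] torOrZero M t n)
      (b : ∀ n, torOrZero M t n →ₗ[R] Ext X M n)
      (c : ∀ n, Ext X M n →ₗ[R] Ext T M (n + 2)),
      Function.Injective (a 0) ∧ (∀ n, Function.Exact (a n) (b n)) ∧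
        (∀ n, Function.Exact (b n) (c n)) ∧ ∀ n, Function.Exact (c n) (a (n + 1)) := by
  let D : ModuleCat.{u} R := ModuleCat.of R (Module.Dual R S)
  let N : ModuleCat.{u} R := ModuleCat.of R (Module.Dual R S ⧸ LinearMap.range j)
  have hjq : Function.Exact j (LinearMap.range j).mkQ := LinearMap.exact_map_mkQ_range j
  have hSE := exactShortComplex_shortExact (N := I) (P := D) (L := N) h.injective hjq
    (Submodule.mkQ_surjective _)
  have hψ := precomp_evalExt (J := D) (M := M)
    (LinearMap.id : Module.Dual R S →ₗ[R] Module.Dual R S) j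
  obtain ⟨a, b, c, ha, hab, hbc, hca⟩ := exists_splice_exact
    (X := fun n => ModuleCat.of R (Ext N M n)) (H := fun n => ModuleCat.of R (Ext D M n))
    (G := fun n => ModuleCat.of R (Ext I M n)) (evalExt D M LinearMap.id)
    (fun n => (Ext.mk₀ (ModuleCat.ofHom (LinearMap.range j).mkQ : D ⟶ N)).precompOfLinear R M
      (zero_add n))
    (fun n => (Ext.mk₀ (ModuleCat.ofHom j : I ⟶ D)).precompOfLinear R M (zero_add n))
    (fun n => hSE.extClass.precompOfLinear R M (add_comm 1 n))
    (injective_precomp_zero hSE M) (exact_precomp₂ hSE M)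
    (fun n => exact_precomp₁ hSE M (add_comm 1 n)) (fun n => exact_precomp₃ hSE M (add_comm 1 n))
  have hs : ∀ n, Nonempty (spliceObj (fun n => ModuleCat.of R (Ext I M n))
      ((Ext.mk₀ (ModuleCat.ofHom j : I ⟶ D)).precompOfLinear R M (zero_add 0) ∘ₗ
        evalExt D M LinearMap.id) n ≃ₗ[R] torOrZero M t n) := by
    -- Restricting the evaluation map of `S^*` to `I` gives the evaluation map of `I`, whose list is
    -- known.
    rw [hψ]
    exact h.splice
  have e := fun n => (hT.nonempty_ext_equiv M n).some
  have f := fun n => (hs n).some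
  refine ⟨N, h.coker, fun n => (f n).toLinearMap ∘ₗ a n ∘ₗ (e n).toLinearMap,
    fun n => b n ∘ₗ (f n).symm.toLinearMap, fun n => (e (n + 1)).symm.toLinearMap ∘ₗ c n,
    (f 0).injective.comp (ha.comp (e 0).injective), fun n x => ?_, fun n x => ?_, fun n x => ?_⟩
  · obtain ⟨x, rfl⟩ := (f n).surjective x
    simp only [LinearMap.comp_apply, LinearEquiv.coe_coe, LinearEquiv.symm_apply_apply, hab n x,
      Set.mem_range, EmbeddingLike.apply_eq_iff_eq]
    exact ((e n).surjective.exists (p := fun y => a n y = x))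
  · simp only [LinearMap.comp_apply, LinearEquiv.coe_coe, LinearEquiv.map_eq_zero_iff, hbc n x,
      Set.mem_range]
    exact ((f n).symm.surjective.exists (p := fun y => b n y = x))
  · obtain ⟨x, rfl⟩ := (e (n + 1)).symm.surjective x
    simp only [LinearMap.comp_apply, LinearEquiv.coe_coe, LinearEquiv.apply_symm_apply,
      LinearEquiv.map_eq_zero_iff, hca n x, Set.mem_range, EmbeddingLike.apply_eq_iff_eq]

end LongExact

/-! ### Dimensions of the terms. -/

section Dimension

variable {R : Type u} [CommRing R] [IsLocalRing R] {X M : ModuleCat.{u} R}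

/-- Over a noetherian ring `Ext^t(k, R)` is finitely generated, hence a finite power of `k`, and
`Ext` is additive. -/
theorem nonempty_ext_equiv_pi_bass [IsNoetherianRing R] {t : ℕ}
    (e : X ≃ₗ[R] Ext (resField R) (ModuleCat.of R R) t) (M : ModuleCat.{u} R) (n : ℕ) :
    Nonempty (Ext X M n ≃ₗ[R] (Fin (bass t (ModuleCat.of R R)) → Ext (resField R) M n)) := by
  have : Module.Finite R (resField R) :=
    Module.Finite.of_surjective (Algebra.linearMap R (ResidueField R)) residue_surjective
  obtain ⟨e'⟩ := (ext_resField_isResidueSpace (ModuleCat.of R R) t).nonempty_equiv_pi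
  obtain ⟨e''⟩ := nonempty_ext_pi_equiv (resField R) M (bass t (ModuleCat.of R R)) n
  exact ⟨extCongrLeft (B := ModuleCat.of R (Fin (bass t (ModuleCat.of R R)) → ResidueField R))
    (e ≪≫ₗ e') M n ≪≫ₗ e''⟩

theorem IsResidueSpace.of_equiv_pi {E F : Type u} [AddCommGroup E] [Module R E] [AddCommGroup F]
    [Module R F] (hF : IsResidueSpace R F) {r : ℕ} (e : E ≃ₗ[R] (Fin r → F)) :
    IsResidueSpace R E := by
  intro x s
  apply e.injective
  ext i
  rw [map_zero]
  exact (congrFun (e.map_smul (s : R) x) i).trans (hF (x := e x i) (a := s))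

theorem IsResidueSpace.dim_of_equiv_pi {E F : Type u} [AddCommGroup E] [Module R E]
    [AddCommGroup F] [Module R F] [Module.Finite R F] (hE : IsResidueSpace R E)
    (hF : IsResidueSpace R F) {r : ℕ} (e : E ≃ₗ[R] (Fin r → F)) : hE.dim = r * hF.dim := by
  have : Module.Finite R E := Module.Finite.equiv e.symm
  have h := e.length_eq
  rw [Module.length_pi_of_fintype, hE.length_eq_dim] at h
  simp only [hF.length_eq_dim, Finset.sum_const, Finset.card_univ, Fintype.card_fin,
    nsmul_eq_mul] at h
  exact_mod_cast h

theorem torOrZero_isResidueSpace (M : ModuleCat.{u} R) (n i : ℕ) :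
    IsResidueSpace R (torOrZero M n i) := by
  by_cases h : i ≤ n
  · rw [torOrZero_of_le M h]
    exact tor_resField_isResidueSpace M (n - i)
  · have := subsingleton_torOrZero M (not_le.1 h)
    intro x r
    exact Subsingleton.elim _ _

theorem dim_torOrZero (M : ModuleCat.{u} R) {n i : ℕ} (h : i ≤ n) :
    (torOrZero_isResidueSpace M n i).dim = betti (n - i) M := by
  have e : torOrZero M n i ≃ₗ[R] ((Tor (ModuleCat.{u} R) (n - i)).obj (resField R)).obj M :=
    (eqToIso (torOrZero_of_le M h)).toLinearEquiv
  exact IsResidueSpace.dim_congr _ _ e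

end Dimension

end LocalExt

/-! ### Reading off the dimensions. -/

theorem theorem3p4 (R : Type u) [CommRing R] [IsNoetherianRing R] [IsLocalRing R]
    (t : ℕ) (ht : LocalExt.depth R R = t)
    (M : ModuleCat.{u} R) [Module.Finite R M] (hM : (t : ℕ∞) ≤ LocalExt.depth R M)
    -- `T` is any module of the form `Tr Ω^t k`
    (S T : ModuleCat.{u} R) (hS : LocalExt.IsSyzygy t (LocalExt.resField R) S)
    (hT : LocalExt.IsTranspose S T) :
    ∃ h : ∀ i : ℕ, 0 < i → LocalExt.IsResidueSpace R (Ext T M i),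
      (∀ i : ℕ, 0 < i → Module.Finite R (Ext T M i)) ∧
      (∀ (i : ℕ) (hi : 1 ≤ i), i ≤ t → (h i hi).dim = LocalExt.betti (t - i + 1) M) ∧
      ((h (t + 1) (by omega)).dim : ℤ) - ((h (t + 2) (by omega)).dim : ℤ) =
        (LocalExt.betti 0 M : ℤ) - (LocalExt.ringType R : ℤ) * (LocalExt.bass t M : ℤ) ∧
      (∀ (i : ℕ) (hi : t + 3 ≤ i),
        (h i (by omega)).dim = LocalExt.ringType R * LocalExt.bass (i - 2) M) := by
  open LocalExt in
  have hR (i : ℕ) (hi : i < t) : Subsingleton (Ext (resField R) (ModuleCat.of R R) i) :=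
    subsingleton_ext_of_lt_depth (ht.symm ▸ Nat.cast_lt.2 hi)
  have hkM (i : ℕ) (hi : i < t) : Subsingleton (Ext (resField R) M i) :=
    subsingleton_ext_of_lt_depth ((Nat.cast_lt.2 hi).trans_le hM)
  have hk : Module.Finite R (resField R) :=
    Module.Finite.of_surjective (Algebra.linearMap R (ResidueField R)) residue_surjective
  have htype : ringType R = bass t (ModuleCat.of R R) := by simp [ringType, ht]
  have hTfin : Module.Finite R T := by
    obtain ⟨P, ⟨e⟩⟩ := hT
    have := P.finite₁
    exact Module.Finite.equiv e.symm
  obtain ⟨I, j, hj⟩ := hS.exists_isDualImage hR M le_rfl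
  obtain ⟨X, ⟨eX⟩, a, b, c, ha, hab, hbc, hca⟩ := hj.exists_long_exact hT
  have f := fun n => (nonempty_ext_equiv_pi_bass eX M n).some
  have hX (n : ℕ) : IsResidueSpace R (Ext X M n) :=
    (ext_resField_isResidueSpace M n).of_equiv_pi (f n)
  have hXdim (n : ℕ) : (hX n).dim = ringType R * bass n M := by
    rw [htype]
    exact (hX n).dim_of_equiv_pi (ext_resField_isResidueSpace M n) (f n)
  have hXfin (n : ℕ) : Module.Finite R (Ext X M n) := Module.Finite.equiv (f n).symm
  have hX0 (n : ℕ) (hn : n < t) : Subsingleton (Ext X M n) := by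
    have := hkM n hn
    exact (f n).toEquiv.subsingleton
  have hinj (n : ℕ) (hn : n ≤ t) : Function.Injective (a n) := by
    cases n with
    | zero => exact ha
    | succ n =>
      have := hX0 n (by omega)
      rw [injective_iff_map_eq_zero]
      intro x hx
      obtain ⟨y, rfl⟩ := (hca n x).1 hx
      rw [Subsingleton.elim y 0, map_zero]
  have hsurj (n : ℕ) (hn : t ≤ n) : Function.Surjective (c n) := fun x => by
    have := subsingleton_torOrZero M (show t < n + 1 by omega)
    exact (hca n x).1 (Subsingleton.elim _ _)
  -- Up to degree `t + 1` the module embeds in a `Tor`; beyond that it is a quotient of some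
  -- `Ext^m(X, M)` with `m ≥ t`.
  have hres (i : ℕ) (hi : 0 < i) : IsResidueSpace R (Ext T M i) := by
    obtain ⟨n, rfl⟩ := Nat.exists_eq_add_one.2 hi
    rcases le_or_gt n t with hn | hn
    · exact (torOrZero_isResidueSpace M t n).of_injective (a n) (hinj n hn)
    · obtain ⟨m, rfl⟩ := Nat.exists_eq_add_one.2 (Nat.zero_lt_of_lt hn)
      exact (hX m).of_surjective (c m) (hsurj m (by omega))
  refine ⟨hres, fun i _ => inferInstance, fun i hi hit => ?_, ?_, fun i hi => ?_⟩
  · obtain ⟨n, rfl⟩ := Nat.exists_eq_add_one.2 hi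
    have := hX0 n (by omega)
    have hs : Function.Surjective (a n) := fun x => (hab n x).1 (Subsingleton.elim _ _)
    rw [(hres _ hi).dim_congr (torOrZero_isResidueSpace M t n)
      (LinearEquiv.ofBijective (a n) ⟨hinj n (by omega), hs⟩), dim_torOrZero M (by omega)]
    congr 1
    omega
  -- Finiteness of the `Tor` term is inherited from its neighbours in the exact sequence.
  · have : Module.Finite R (torOrZero M t t) := by
      have hab' : Function.Exact (a t) (b t).rangeRestrict :=
        fun x => Subtype.ext_iff.trans (hab t x)
      exact Module.Finite.of_exact hab' (b t).surjective_rangeRestrict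
    have h := dim_sub_dim_of_exact (hres (t + 1) (by omega)) (torOrZero_isResidueSpace M t t)
      (hX t) (hres (t + 2) (by omega)) (a t) (b t) (c t) (hinj t le_rfl) (hab t) (hbc t)
      (hsurj t le_rfl)
    rw [h, hXdim, dim_torOrZero M le_rfl, Nat.sub_self, Nat.cast_mul]
  · obtain ⟨n, rfl⟩ : ∃ n, i = n + 2 := ⟨i - 2, by omega⟩
    have hin : Function.Injective (c n) := by
      have := subsingleton_torOrZero M (show t < n by omega)
      rw [injective_iff_map_eq_zero]
      intro x hx
      obtain ⟨y, rfl⟩ := (hbc n x).1 hx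
      rw [Subsingleton.elim y 0, map_zero]
    rw [← (hX n).dim_congr (hres (n + 2) (by omega))
      (LinearEquiv.ofBijective (c n) ⟨hin, hsurj n (by omega)⟩), hXdim]
    rfl
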